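/- Let $(M,\tau)$ be a von Neumann algebra with a faithful normal tracial state, and let $A,B\subset N\subset M$ be (unital) von Neumann subalgebras. Write $\|x\|_2=\tau(x^*x)^{1/2}$, let $L^2(M)$ be the completion of $M$ for $\|\cdot\|_2$ with its left and right actions of $M$, let $L^2(N)\subset L^2(M)$ be the closure of $N$, let $E_B,E_N$ be the $\tau$-preserving conditional expectations, and let $(P)_1$ be the operator-norm unit ball of $P$. Let $\mathcal H\subset L^2(M)\ominus L^2(N)$ be a closed subspace stable under the left and right actions of $N$, and assume that $\mathcal H$ is compact relative to $B\subset N$ as an $A$-$A$ bimodule: whenever $x_n\in(A)_1$ is a sequence with $\|E_B(yx_nz)\|_2\to0$ for all $y,z\in N$, then $\langle x_n\xi y_n,\xi\rangle\to0$ for every sequence $y_n\in(A)_1$ and every $\xi\in\mathcal H$. Let $(\phi_t)_{t\ge0}$ be a symmetric semigroup on $N$, that is, linear maps $\phi_t:N\to N$ with $\phi_0=\mathrm{id}$, $\phi_{s+t}=\phi_s\phi_t$ and $\tau(\phi_t(x)y)=\tau(x\phi_t(y))$ for all $x,y\in N$, and let $\alpha_t:N\to M$ ($t\ge0$) be unital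 $*$-homomorphisms dilating it, that is, $E_N(\alpha_t(x))=\phi_t(x)$ for all $x\in N$ and $t\ge 0$ (so that the $\phi_t$ are automatically unital and completely positive). Assume that $\alpha_t(x)-\phi_t(x)\in\mathcal H$ for all $x\in N$ and $t\ge0$. Suppose that $A$ does not embed into $B$ inside $N$, that is, there is a sequence of unitaries $u_k\in A$ with $\|E_B(a^*u_kb)\|_2\to0$ for all $a,b\in N$. If $$\lim_{t\to0^+}\ \sup_{x\in(A)_1}\|\alpha_t(x)-x\|_2=0,$$ then $$\lim_{t\to0^+}\ \sup_{x\in(\mathcal N_N(A)'')_1}\|\alpha_t(x)-x\|_2=0,$$ where $\mathcal N_N(A)=\{u\in N\text{ unitary}: uAu^*=A\}$ and $\mathcal N_N(A)''$ is the von Neumann algebra it generates. -/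

import Mathlib

open Filter Topology
open scoped NNReal InnerProductSpace

noncomputable section

universe u

/-- A faithful normal tracial state on a von Neumann algebra `M ⊆ B(K)`.  Normality is expressed by
a density operator: `τ` is a sum of vector functionals `∑ ⟨ξₙ, · ξₙ⟩` with `∑ ‖ξₙ‖² < ∞`.
Positivity of `τ` is part of this. -/
structure TracialState {K : Type u} [NormedAddCommGroup K] [InnerProductSpace ℂ K]
    [CompleteSpace K] (M : VonNeumannAlgebra K) where
  toLinearMap : M.toStarSubalgebra →ₗ[ℂ] ℂ
  map_one : toLinearMap 1 = 1
  map_mul_comm : ∀ x y : M.toStarSubalgebra, toLinearMap (x * y) = toLinearMap (y * x)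
  faithful : ∀ x : M.toStarSubalgebra, toLinearMap (star x * x) = 0 → x = 0
  normal : ∃ ξ : ℕ → K, (Summable fun n => ‖ξ n‖ ^ 2) ∧
    ∀ x : M.toStarSubalgebra,
      HasSum (fun n => ⟪ξ n, (x : K →L[ℂ] K) (ξ n)⟫_ℂ) (toLinearMap x)

namespace TracialState

variable {K : Type u} [NormedAddCommGroup K] [InnerProductSpace ℂ K] [CompleteSpace K]
  {M : VonNeumannAlgebra K} (τ : TracialState M)

instance : CoeFun (TracialState M) (fun _ => M.toStarSubalgebra → ℂ) := ⟨fun τ => τ.toLinearMap⟩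

theorem exists_hasSum_star_mul : ∃ ξ : ℕ → K, ∀ x y : M.toStarSubalgebra,
    HasSum (fun n => ⟪(x : K →L[ℂ] K) (ξ n), (y : K →L[ℂ] K) (ξ n)⟫_ℂ) (τ (star x * y)) := by
  obtain ⟨ξ, -, h⟩ := τ.normal
  refine ⟨ξ, fun x y => ?_⟩
  have := h (star x * y)
  simpa [ContinuousLinearMap.star_eq_adjoint, ContinuousLinearMap.adjoint_inner_right] using this

theorem hasSum_norm_sq {ξ : ℕ → K} (h : ∀ x y : M.toStarSubalgebra,
    HasSum (fun n => ⟪(x : K →L[ℂ] K) (ξ n), (y : K →L[ℂ] K) (ξ n)⟫_ℂ) (τ (star x * y)))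
    (x : M.toStarSubalgebra) :
    HasSum (fun n => ‖(x : K →L[ℂ] K) (ξ n)‖ ^ 2) (τ (star x * x)).re := by
  have := Complex.hasSum_re (h x x)
  refine this.congr_fun fun n => ?_
  rw [← inner_self_eq_norm_sq (𝕜 := ℂ)]
  rfl

/-- `M` as a vector space, to be equipped with the inner product `⟨x, y⟩ = τ (x* y)`. -/
def PreL2 (_τ : TracialState M) : Type u := M.toStarSubalgebra

instance : AddCommGroup τ.PreL2 := inferInstanceAs (AddCommGroup M.toStarSubalgebra)
instance : Module ℂ τ.PreL2 := inferInstanceAs (Module ℂ M.toStarSubalgebra)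

/-- The identity map from `M` to `PreL2`. -/
def toPreL2 : M.toStarSubalgebra ≃ₗ[ℂ] τ.PreL2 := LinearEquiv.refl ℂ _

/-- The inner product `⟨x, y⟩ = τ (x* y)` on `M`. -/
abbrev preL2Core : InnerProductSpace.Core ℂ τ.PreL2 where
  inner a b := τ (star (τ.toPreL2.symm a) * τ.toPreL2.symm b)
  conj_inner_symm a b := by
    obtain ⟨ξ, h⟩ := τ.exists_hasSum_star_mul
    refine HasSum.unique ?_ (h _ _)
    have := (Complex.hasSum_conj'.2 (h (τ.toPreL2.symm b) (τ.toPreL2.symm a)))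
    simpa using this
  re_inner_nonneg a := by
    obtain ⟨ξ, h⟩ := τ.exists_hasSum_star_mul
    exact (τ.hasSum_norm_sq h _).nonneg fun n => by positivity
  add_left a b c := by simp [add_mul]
  smul_left a b c := by simp
  definite a h := τ.faithful _ h

instance : NormedAddCommGroup τ.PreL2 :=
  InnerProductSpace.Core.toNormedAddCommGroup (cd := τ.preL2Core)

instance : InnerProductSpace ℂ τ.PreL2 := InnerProductSpace.ofCore τ.preL2Core.toCore

theorem preL2_inner_def (a b : τ.PreL2) :
    ⟪a, b⟫_ℂ = τ (star (τ.toPreL2.symm a) * τ.toPreL2.symm b) := rfl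

theorem preL2_norm_sq (a : τ.PreL2) :
    ‖a‖ ^ 2 = (τ (star (τ.toPreL2.symm a) * τ.toPreL2.symm a)).re := by
  rw [← inner_self_eq_norm_sq (𝕜 := ℂ)]
  rfl

/-- The Hilbert space `L²(M, τ)`: the completion of `M` for `‖x‖₂ = τ (x* x)^(1/2)`. -/
abbrev L2 : Type u := UniformSpace.Completion τ.PreL2

/-- The canonical embedding `M → L²(M, τ)`. -/
def toL2 : M.toStarSubalgebra →ₗ[ℂ] τ.L2 :=
  (UniformSpace.Completion.toComplL (𝕜 := ℂ) (E := τ.PreL2)).toLinearMap ∘ₗ τ.toPreL2.toLinearMap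

theorem preL2_norm_mul_le (x : M.toStarSubalgebra) (a : τ.PreL2) :
    ‖τ.toPreL2 (x * τ.toPreL2.symm a)‖ ≤ ‖x‖ * ‖a‖ := by
  obtain ⟨ξ, h⟩ := τ.exists_hasSum_star_mul
  refine le_of_sq_le_sq ?_ (by positivity)
  rw [mul_pow, preL2_norm_sq, preL2_norm_sq]
  refine hasSum_le (fun n => ?_) (τ.hasSum_norm_sq h _)
    ((τ.hasSum_norm_sq h (τ.toPreL2.symm a)).mul_left (‖x‖ ^ 2))
  rw [← mul_pow]
  gcongr
  exact (x : K →L[ℂ] K).le_opNorm _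

theorem preL2_norm_star (x : M.toStarSubalgebra) :
    ‖τ.toPreL2 (star x)‖ = ‖τ.toPreL2 x‖ := by
  have : ‖τ.toPreL2 (star x)‖ ^ 2 = ‖τ.toPreL2 x‖ ^ 2 := by
    rw [preL2_norm_sq, preL2_norm_sq]
    simp [τ.map_mul_comm x (star x)]
  exact (sq_eq_sq₀ (norm_nonneg _) (norm_nonneg _)).1 this

theorem preL2_norm_mul_le' (y : M.toStarSubalgebra) (a : τ.PreL2) :
    ‖τ.toPreL2 (τ.toPreL2.symm a * y)‖ ≤ ‖y‖ * ‖a‖ := by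
  have h := τ.preL2_norm_mul_le (star y) (τ.toPreL2 (star (τ.toPreL2.symm a)))
  rw [preL2_norm_star] at h
  rw [← preL2_norm_star, star_mul]
  simpa using h

/-- The left action `ξ ↦ x ξ` of `x ∈ M` on `L²(M, τ)`. -/
def leftMul (x : M.toStarSubalgebra) : τ.L2 →L[ℂ] τ.L2 :=
  ((τ.toPreL2.toLinearMap ∘ₗ LinearMap.mulLeft ℂ x ∘ₗ
    τ.toPreL2.symm.toLinearMap).mkContinuous ‖x‖ (τ.preL2_norm_mul_le x)).completion

/-- The right action `ξ ↦ ξ y` of `y ∈ M` on `L²(M, τ)`. -/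
def rightMul (y : M.toStarSubalgebra) : τ.L2 →L[ℂ] τ.L2 :=
  ((τ.toPreL2.toLinearMap ∘ₗ LinearMap.mulRight ℂ y ∘ₗ
    τ.toPreL2.symm.toLinearMap).mkContinuous ‖y‖ (τ.preL2_norm_mul_le' y)).completion

theorem inner_toL2 (x y : M.toStarSubalgebra) :
    ⟪τ.toL2 x, τ.toL2 y⟫_ℂ = τ (star x * y) :=
  UniformSpace.Completion.inner_coe (𝕜 := ℂ) (τ.toPreL2 x) (τ.toPreL2 y)

theorem leftMul_toL2 (x y : M.toStarSubalgebra) : τ.leftMul x (τ.toL2 y) = τ.toL2 (x * y) :=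
  ContinuousLinearMap.completion_apply_coe _ (τ.toPreL2 y)

theorem rightMul_toL2 (x y : M.toStarSubalgebra) : τ.rightMul y (τ.toL2 x) = τ.toL2 (x * y) :=
  ContinuousLinearMap.completion_apply_coe _ (τ.toPreL2 x)

/-- The closed subspace `L²(P) ⊆ L²(M)` of a von Neumann subalgebra `P ⊆ M`. -/
def subL2 (P : VonNeumannAlgebra K) : Submodule ℂ τ.L2 :=
  ((P.toStarSubalgebra.toSubalgebra.toSubmodule.comap
    M.toStarSubalgebra.toSubalgebra.val.toLinearMap).map τ.toL2).topologicalClosure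

instance (P : VonNeumannAlgebra K) : (τ.subL2 P).HasOrthogonalProjection :=
  haveI : CompleteSpace (τ.subL2 P) :=
    (Submodule.isClosed_topologicalClosure _).completeSpace_coe
  inferInstance

/-- The trace preserving conditional expectation `E_P(x)` of `x ∈ M` onto a von Neumann subalgebra
`P ⊆ M`, regarded as an element of `L²(M)`: the orthogonal projection of `x` onto `L²(P)`. -/
def condExp (P : VonNeumannAlgebra K) (x : M.toStarSubalgebra) : τ.L2 :=
  (τ.subL2 P).starProjection (τ.toL2 x)

/-- For von Neumann subalgebras `A, B ⊆ N ⊆ M`: `A` embeds into `B` inside `N`, i.e. there is no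
sequence of unitaries `uₖ ∈ A` with `‖E_B(a* uₖ b)‖₂ → 0` for all `a, b ∈ N`. -/
def EmbedsInside (A B N : VonNeumannAlgebra K) : Prop :=
  ¬ ∃ u : ℕ → M.toStarSubalgebra,
    (∀ k, (u k : K →L[ℂ] K) ∈ A ∧ u k ∈ unitary M.toStarSubalgebra) ∧
    ∀ a b : M.toStarSubalgebra, (a : K →L[ℂ] K) ∈ N → (b : K →L[ℂ] K) ∈ N →
      Tendsto (fun k => ‖τ.condExp B (star a * u k * b)‖) atTop (𝓝 0)

/-- A closed subspace of `L²(M)` that is stable under the left and right actions of `N ⊆ M`. -/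
structure IsHilbertBimodule (N : VonNeumannAlgebra K) (H : Submodule ℂ τ.L2) : Prop where
  isClosed : IsClosed (H : Set τ.L2)
  leftMul_mem : ∀ x : M.toStarSubalgebra, (x : K →L[ℂ] K) ∈ N → ∀ ξ ∈ H, τ.leftMul x ξ ∈ H
  rightMul_mem : ∀ x : M.toStarSubalgebra, (x : K →L[ℂ] K) ∈ N → ∀ ξ ∈ H, τ.rightMul x ξ ∈ H

/-- `H` is compact relative to `B ⊆ N` as an `A`-`A` bimodule: if `xₙ ∈ (A)₁` and
`‖E_B(y xₙ z)‖₂ → 0` for all `y, z ∈ N`, then `⟨xₙ ξ yₙ, ξ⟩ → 0` for all `yₙ ∈ (A)₁`, `ξ ∈ H`. -/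
def IsCompactRelative (A B N : VonNeumannAlgebra K) (H : Submodule ℂ τ.L2) : Prop :=
  ∀ x : ℕ → M.toStarSubalgebra, (∀ n, (x n : K →L[ℂ] K) ∈ A ∧ ‖x n‖ ≤ 1) →
    (∀ y z : M.toStarSubalgebra, (y : K →L[ℂ] K) ∈ N → (z : K →L[ℂ] K) ∈ N →
      Tendsto (fun n => ‖τ.condExp B (y * x n * z)‖) atTop (𝓝 0)) →
    ∀ y : ℕ → M.toStarSubalgebra, (∀ n, (y n : K →L[ℂ] K) ∈ A ∧ ‖y n‖ ≤ 1) → ∀ ξ ∈ H,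
      Tendsto (fun n => ⟪ξ, τ.leftMul (x n) (τ.rightMul (y n) ξ)⟫_ℂ) atTop (𝓝 0)

end TracialState

/-- The inclusion `N → M` of von Neumann algebras on the same Hilbert space. -/
def VonNeumannAlgebra.incl {K : Type u} [NormedAddCommGroup K] [InnerProductSpace ℂ K]
    [CompleteSpace K] {N M : VonNeumannAlgebra K} (h : N ≤ M) :
    N.toStarSubalgebra →⋆ₐ[ℂ] M.toStarSubalgebra :=
  StarSubalgebra.inclusion (S₁ := N.toStarSubalgebra) (S₂ := M.toStarSubalgebra) h

/-- A one-parameter semigroup `(φ_t)_{t ≥ 0}` of linear maps on `N ⊆ M` that is symmetric for the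
trace: `τ(φ_t(x) y) = τ(x φ_t(y))`.  Complete positivity and contractivity of `φ_t` are not listed:
they follow when `φ_t = E_N ∘ α_t` for `*`-homomorphisms `α_t`. -/
structure IsSymmetricSemigroup {K : Type u} [NormedAddCommGroup K] [InnerProductSpace ℂ K]
    [CompleteSpace K] {N M : VonNeumannAlgebra K} (h : N ≤ M) (τ : TracialState M)
    (φ : ℝ≥0 → N.toStarSubalgebra →ₗ[ℂ] N.toStarSubalgebra) : Prop where
  zero : φ 0 = LinearMap.id
  add : ∀ s t, φ (s + t) = φ s ∘ₗ φ t
  symm : ∀ t x y, τ (VonNeumannAlgebra.incl h (φ t x * y)) = τ (VonNeumannAlgebra.incl h (x * φ t y))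

/-- The `*`-homomorphisms `α_t : N → M` dilate `φ_t`: `E_N(α_t(x)) = φ_t(x)`. -/
def IsDilation {K : Type u} [NormedAddCommGroup K] [InnerProductSpace ℂ K]
    [CompleteSpace K] {N M : VonNeumannAlgebra K} (h : N ≤ M) (τ : TracialState M)
    (α : ℝ≥0 → N.toStarSubalgebra →⋆ₐ[ℂ] M.toStarSubalgebra)
    (φ : ℝ≥0 → N.toStarSubalgebra →ₗ[ℂ] N.toStarSubalgebra) : Prop :=
  ∀ t x, τ.condExp N (α t x) = τ.toL2 (VonNeumannAlgebra.incl h (φ t x))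

/-- The normalizer `𝒩_N(A) = {u ∈ 𝒰(N) : u A u* = A}`, as a set of operators. -/
def normalizerSet {K : Type u} [NormedAddCommGroup K] [InnerProductSpace ℂ K]
    [CompleteSpace K] (N A : VonNeumannAlgebra K) : Set (K →L[ℂ] K) :=
  {u | u ∈ N ∧ u ∈ unitary (K →L[ℂ] K) ∧
    (fun a => u * a * star u) '' (A : Set (K →L[ℂ] K)) = (A : Set (K →L[ℂ] K))}

/-- `α_t → id` as `t → 0⁺`, uniformly in `‖·‖₂` on the operator-norm unit ball of `S ⊆ N`. -/
def ConvergesUniformlyOnBall {K : Type u} [NormedAddCommGroup K] [InnerProductSpace ℂ K]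
    [CompleteSpace K] {N M : VonNeumannAlgebra K} (h : N ≤ M) (τ : TracialState M)
    (α : ℝ≥0 → N.toStarSubalgebra →⋆ₐ[ℂ] M.toStarSubalgebra) (S : Set (K →L[ℂ] K)) : Prop :=
  TendstoUniformlyOn (fun t x => τ.toL2 (α t x)) (fun x => τ.toL2 (VonNeumannAlgebra.incl h x))
    (𝓝[>] 0) {x : N.toStarSubalgebra | (x : K →L[ℂ] K) ∈ S ∧ ‖x‖ ≤ 1}

end

/-!
Fix `α`, `φ` and `β` at times `t`, `t` and `2t`, and let `α` be `ε`-close to the identity on `(A)₁`.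
For `w` in the normalizer and unitaries `vₖ ∈ A` vanishing relative to `B`, put `aₖ = w vₖ w*`.
From `α(aₖ) α(w) = α(w) α(vₖ)` one gets `‖α(w) vₖ - aₖ α(w)‖₂ ≤ 2ε`, and projecting onto `L²(N)ᗮ`
gives `‖δ vₖ - aₖ δ‖₂ ≤ 2ε` for `δ = α(w) - φ(w)`. Hence `δ` is within `2ε` of `aₖ δ vₖ*`, which is
asymptotically orthogonal to `δ` by relative compactness, so `‖δ‖₂ ≤ 2ε`.

Transversality, `‖β(x) - x‖₂² = 2 ‖α(x) - φ(x)‖₂²`, turns this into `‖β(w) - w‖₂ ≤ 3ε` on the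
normalizer. The vector `ξ` of minimal norm in the closed convex hull of the `w* β(w)` then satisfies
`w ξ = ξ β(w)` and `‖ξ - 1‖₂ ≤ 3ε`. Unlike the estimate, the identity `x ξ = ξ β(x)` is linear,
so it passes to the whole bicommutant, where it yields `‖β(x) - x‖₂ ≤ 6ε` for `‖x‖ ≤ 1`.
-/

section MinimalNorm

variable {E : Type*} [NormedAddCommGroup E] [InnerProductSpace ℝ E] [CompleteSpace E]

theorem exists_forall_eq_of_norm_le {C : Set E} (hne : C.Nonempty)
    (hclosed : IsClosed C) (hconv : Convex ℝ C) :
    ∃ ξ ∈ C, ∀ η ∈ C, ‖η‖ ≤ ‖ξ‖ → η = ξ := by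
  obtain ⟨ξ, hξC, hξ⟩ :=
    exists_norm_eq_iInf_of_complete_convex hne hclosed.isComplete hconv 0
  have hmin : ∀ η ∈ C, ‖ξ‖ ≤ ‖η‖ := fun η hη => by
    have hbdd : BddBelow (Set.range fun w : C => ‖0 - (w : E)‖) :=
      ⟨0, Set.forall_mem_range.2 fun _ => norm_nonneg _⟩
    simpa using hξ.le.trans (ciInf_le hbdd ⟨η, hη⟩)
  refine ⟨ξ, hξC, fun η hηC hη => ?_⟩
  by_contra hne
  have hmid : (1 / 2 : ℝ) • (η + ξ) ∈ C := by
    rw [smul_add]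
    exact hconv hηC hξC (by norm_num) (by norm_num) (by norm_num)
  have hnorm : ‖η‖ = ‖ξ‖ := le_antisymm hη (hmin η hηC)
  exact (hmin _ hmid).not_gt (((norm_midpoint_lt_iff hnorm).2 hne).trans_eq hnorm)

theorem exists_mem_closedBall_fixed_of_mapsTo {ι : Type*} {S : Set E} (hne : S.Nonempty)
    {e : E} {c : ℝ} (hSc : S ⊆ Metric.closedBall e c) {T : ι → E →L[ℝ] E}
    (hT : ∀ i, ‖T i‖ ≤ 1) (hTS : ∀ i, Set.MapsTo (T i) S S) :
    ∃ ξ ∈ Metric.closedBall e c, ∀ i, T i ξ = ξ := by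
  have hTC : ∀ i, Set.MapsTo (T i) (closedConvexHull ℝ S) (closedConvexHull ℝ S) := fun i =>
    closedConvexHull_min (fun η hη => subset_closedConvexHull (hTS i hη))
      (convex_closedConvexHull.linear_preimage (T i).toLinearMap)
      (isClosed_closedConvexHull.preimage (T i).continuous)
  obtain ⟨ξ, hξC, hξ⟩ := exists_forall_eq_of_norm_le
    (hne.mono subset_closedConvexHull) isClosed_closedConvexHull convex_closedConvexHull
  exact ⟨ξ, closedConvexHull_min hSc (convex_closedBall e c) Metric.isClosed_closedBall hξC,
    fun i => hξ _ (hTC i hξC) ((T i).le_of_opNorm_le (hT i) ξ |>.trans_eq (one_mul _))⟩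

end MinimalNorm

section Bicommutant

variable {𝕜 E : Type*} [RCLike 𝕜] [NormedAddCommGroup E] [InnerProductSpace 𝕜 E]
  [CompleteSpace E]

theorem starProjection_mem_centralizer {S : Set (E →L[𝕜] E)} (hS : ∀ s ∈ S, star s ∈ S)
    {V : Submodule 𝕜 E} [V.HasOrthogonalProjection] (hV : ∀ s ∈ S, ∀ v ∈ V, s v ∈ V) :
    V.starProjection ∈ S.centralizer := by
  refine Set.mem_centralizer_iff.2 fun s hs => ContinuousLinearMap.ext fun v => ?_
  refine (Submodule.eq_starProjection_of_mem_of_inner_eq_zero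
    (hV s hs _ (V.starProjection_apply_mem v)) fun w hw => ?_).symm
  change ⟪s v - s (V.starProjection v), w⟫_𝕜 = 0
  rw [← map_sub, ← ContinuousLinearMap.adjoint_inner_right]
  exact V.starProjection_inner_eq_zero v _ (hV _ (hS s hs) w hw)

theorem apply_mem_of_mem_centralizer_centralizer {S : Set (E →L[𝕜] E)}
    (hS : ∀ s ∈ S, star s ∈ S) {V : Submodule 𝕜 E} [V.HasOrthogonalProjection]
    (hV : ∀ s ∈ S, ∀ v ∈ V, s v ∈ V) {x : E →L[𝕜] E} (hx : x ∈ S.centralizer.centralizer)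
    {v : E} (hv : v ∈ V) : x v ∈ V := by
  have hcomm := DFunLike.congr_fun
    (Set.mem_centralizer_iff.1 hx _ (starProjection_mem_centralizer hS hV)) v
  rw [mul_apply_eq_comp, mul_apply_eq_comp,
    Submodule.starProjection_eq_self_iff.2 hv] at hcomm
  exact Submodule.starProjection_eq_self_iff.1 hcomm

variable (𝕜 E) (ι : Type*)

/-- The amplification `T ↦ T ⊕ T ⊕ ⋯` from operators on `E` to operators on `ℓ²(ι, E)`. -/
noncomputable def amplify :
    (E →L[𝕜] E) →⋆ₐ[𝕜] (lp (fun _ : ι => E) 2 →L[𝕜] lp (fun _ : ι => E) 2) where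
  toFun T := lp.mapCLM 2 (fun _ => T) (norm_nonneg T) fun _ => le_rfl
  map_one' := rfl
  map_mul' _ _ := rfl
  map_zero' := rfl
  map_add' _ _ := rfl
  commutes' _ := rfl
  map_star' T := by
    refine (ContinuousLinearMap.eq_adjoint_iff _ _).2 fun f g => ?_
    simp [lp.inner_eq_tsum, ContinuousLinearMap.star_eq_adjoint,
      ContinuousLinearMap.adjoint_inner_left]

variable {𝕜 E ι}

theorem amplify_apply (T : E →L[𝕜] E) (f : lp (fun _ : ι => E) 2) (i : ι) :
    amplify 𝕜 E ι T f i = T (f i) := rfl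

theorem amplify_single [DecidableEq ι] (T : E →L[𝕜] E) (i : ι) (v : E) :
    amplify 𝕜 E ι T (lp.single 2 i v) = lp.single 2 i (T v) := by
  ext j
  simp only [amplify_apply, lp.single_apply, apply_ite T, Pi.single_apply, map_zero]

theorem amplify_mem_centralizer_centralizer {S : Set (E →L[𝕜] E)} {x : E →L[𝕜] E}
    (hx : x ∈ S.centralizer.centralizer) :
    amplify 𝕜 E ι x ∈ (amplify 𝕜 E ι '' S).centralizer.centralizer := by
  classical
  refine Set.mem_centralizer_iff.2 fun T hT => ?_
  have hentry : ∀ i j, lp.evalCLM 𝕜 (fun _ : ι => E) 2 i ∘L T ∘L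
      lp.singleContinuousLinearMap 𝕜 (fun _ : ι => E) 2 j ∈ S.centralizer := fun i j => by
    refine Set.mem_centralizer_iff.2 fun s hs => ContinuousLinearMap.ext fun v => ?_
    have hcomm := DFunLike.congr_fun
      (Set.mem_centralizer_iff.1 hT _ (Set.mem_image_of_mem _ hs)) (lp.single 2 j v)
    simp only [mul_apply_eq_comp, amplify_single] at hcomm
    exact congr_arg (fun f : lp (fun _ : ι => E) 2 => f i) hcomm
  refine lp.ext_continuousLinearMap (by norm_num) fun j => ?_
  ext v i
  have hcomm := DFunLike.congr_fun (Set.mem_centralizer_iff.1 hx _ (hentry i j)) v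
  simp only [ContinuousLinearMap.comp_apply, mul_apply_eq_comp,
    lp.singleContinuousLinearMap_apply, amplify_single, amplify_apply]
  exact hcomm

theorem amplify_apply_mem_closure_span {G : Submonoid (E →L[𝕜] E)} (hG : ∀ g ∈ G, star g ∈ G)
    {x : E →L[𝕜] E} (hx : x ∈ (G : Set (E →L[𝕜] E)).centralizer.centralizer)
    (η : lp (fun _ : ι => E) 2) :
    amplify 𝕜 E ι x η ∈
      (Submodule.span 𝕜 ((fun g => amplify 𝕜 E ι g η) '' G)).topologicalClosure := by
  set V := Submodule.span 𝕜 ((fun g => amplify 𝕜 E ι g η) '' G)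
  have hV : ∀ s ∈ amplify 𝕜 E ι '' (G : Set (E →L[𝕜] E)), ∀ v ∈ V.topologicalClosure,
      s v ∈ V.topologicalClosure := by
    rintro _ ⟨g, hg, rfl⟩
    refine Set.MapsTo.closure (fun v hv => ?_) (amplify 𝕜 E ι g).continuous
    refine Submodule.span_le (p := V.comap (amplify 𝕜 E ι g).toLinearMap).2 ?_ hv
    rintro _ ⟨h, hh, rfl⟩
    exact Submodule.subset_span ⟨g * h, mul_mem hg hh, by simp⟩
  have : CompleteSpace V.topologicalClosure := V.isClosed_topologicalClosure.completeSpace_coe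
  refine apply_mem_of_mem_centralizer_centralizer ?_ hV (amplify_mem_centralizer_centralizer hx)
    (V.le_topologicalClosure (Submodule.subset_span ⟨1, one_mem G, by simp⟩))
  rintro _ ⟨g, hg, rfl⟩
  exact ⟨star g, hG g hg, map_star _ _⟩

end Bicommutant

theorem norm_le_one_of_mem_unitary {R : Type*} [NormedRing R] [StarRing R] [CStarRing R] {u : R}
    (hu : u ∈ unitary R) : ‖u‖ ≤ 1 := by
  rcases subsingleton_or_nontrivial R with _ | _
  · simp [Subsingleton.elim u 0]
  · exact (CStarRing.norm_of_mem_unitary hu).le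

theorem isClosed_coe_vonNeumannAlgebra {K : Type*} [NormedAddCommGroup K]
    [InnerProductSpace ℂ K] [CompleteSpace K] (M : VonNeumannAlgebra K) :
    IsClosed (M : Set (K →L[ℂ] K)) := by
  rw [← M.centralizer_centralizer]
  exact Set.isClosed_centralizer _

theorem norm_starAlgHom_apply_le {K L : Type*} [NormedAddCommGroup K] [InnerProductSpace ℂ K]
    [CompleteSpace K] [NormedAddCommGroup L] [InnerProductSpace ℂ L] [CompleteSpace L]
    {N : VonNeumannAlgebra K} {M : VonNeumannAlgebra L}
    (α : N.toStarSubalgebra →⋆ₐ[ℂ] M.toStarSubalgebra) (x : N.toStarSubalgebra) :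
    ‖α x‖ ≤ ‖x‖ := by
  have : IsClosed (N.toStarSubalgebra : Set (K →L[ℂ] K)) := isClosed_coe_vonNeumannAlgebra N
  have : IsClosed (M.toStarSubalgebra : Set (L →L[ℂ] L)) := isClosed_coe_vonNeumannAlgebra M
  exact NonUnitalStarAlgHom.norm_apply_le α x

namespace TracialState

variable {K : Type*} [NormedAddCommGroup K] [InnerProductSpace ℂ K] [CompleteSpace K]
  {M : VonNeumannAlgebra K} (τ : TracialState M)

theorem norm_toL2 (x : M.toStarSubalgebra) : ‖τ.toL2 x‖ = ‖τ.toPreL2 x‖ :=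
  UniformSpace.Completion.norm_coe (τ.toPreL2 x)

theorem norm_toL2_sq (x : M.toStarSubalgebra) : ‖τ.toL2 x‖ ^ 2 = (τ (star x * x)).re := by
  rw [norm_toL2, preL2_norm_sq, LinearEquiv.symm_apply_apply]

theorem norm_toL2_mul_le_left (x y : M.toStarSubalgebra) :
    ‖τ.toL2 (x * y)‖ ≤ ‖x‖ * ‖τ.toL2 y‖ := by
  simpa only [norm_toL2, LinearEquiv.symm_apply_apply] using τ.preL2_norm_mul_le x (τ.toPreL2 y)

theorem norm_toL2_mul_le_right (x y : M.toStarSubalgebra) :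
    ‖τ.toL2 (x * y)‖ ≤ ‖y‖ * ‖τ.toL2 x‖ := by
  simpa only [norm_toL2, LinearEquiv.symm_apply_apply] using τ.preL2_norm_mul_le' y (τ.toPreL2 x)

theorem toL2_injective : Function.Injective τ.toL2 := by
  refine (injective_iff_map_eq_zero τ.toL2).2 fun x hx => τ.faithful x ?_
  rw [← inner_toL2, hx, inner_zero_left]

theorem denseRange_toL2 : DenseRange τ.toL2 :=
  UniformSpace.Completion.denseRange_coe (α := τ.PreL2)

theorem continuousLinearMap_ext {S T : τ.L2 →L[ℂ] τ.L2}
    (h : ∀ x, S (τ.toL2 x) = T (τ.toL2 x)) : S = T :=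
  DFunLike.coe_injective (τ.denseRange_toL2.equalizer S.continuous T.continuous (funext h))

theorem leftMul_mul (x y : M.toStarSubalgebra) :
    τ.leftMul (x * y) = τ.leftMul x ∘L τ.leftMul y :=
  τ.continuousLinearMap_ext fun z => by
    simp only [ContinuousLinearMap.comp_apply, leftMul_toL2, mul_assoc]

theorem rightMul_mul (x y : M.toStarSubalgebra) :
    τ.rightMul (x * y) = τ.rightMul y ∘L τ.rightMul x :=
  τ.continuousLinearMap_ext fun z => by
    simp only [ContinuousLinearMap.comp_apply, rightMul_toL2, mul_assoc]

theorem leftMul_comp_rightMul (x y : M.toStarSubalgebra) :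
    τ.leftMul x ∘L τ.rightMul y = τ.rightMul y ∘L τ.leftMul x :=
  τ.continuousLinearMap_ext fun z => by
    simp only [ContinuousLinearMap.comp_apply, leftMul_toL2, rightMul_toL2, mul_assoc]

theorem leftMul_one : τ.leftMul 1 = ContinuousLinearMap.id ℂ τ.L2 :=
  τ.continuousLinearMap_ext fun z => by rw [leftMul_toL2, one_mul, ContinuousLinearMap.id_apply]

theorem rightMul_one : τ.rightMul 1 = ContinuousLinearMap.id ℂ τ.L2 :=
  τ.continuousLinearMap_ext fun z => by rw [rightMul_toL2, mul_one, ContinuousLinearMap.id_apply]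

theorem norm_leftMul_le (x : M.toStarSubalgebra) : ‖τ.leftMul x‖ ≤ ‖x‖ :=
  (τ.leftMul x).opNorm_le_bound (norm_nonneg x) fun ξ =>
    τ.denseRange_toL2.induction_on ξ (isClosed_le (by fun_prop) (by fun_prop)) fun z => by
      rw [leftMul_toL2]
      exact τ.norm_toL2_mul_le_left x z

theorem norm_rightMul_le (x : M.toStarSubalgebra) : ‖τ.rightMul x‖ ≤ ‖x‖ :=
  (τ.rightMul x).opNorm_le_bound (norm_nonneg x) fun ξ =>
    τ.denseRange_toL2.induction_on ξ (isClosed_le (by fun_prop) (by fun_prop)) fun z => by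
      rw [rightMul_toL2]
      exact τ.norm_toL2_mul_le_right z x

theorem inner_leftMul_right (x : M.toStarSubalgebra) (η ξ : τ.L2) :
    ⟪η, τ.leftMul x ξ⟫_ℂ = ⟪τ.leftMul (star x) η, ξ⟫_ℂ :=
  τ.denseRange_toL2.induction_on₂ (isClosed_eq (by fun_prop) (by fun_prop)) (fun y z => by
    simp only [leftMul_toL2, inner_toL2, star_mul, star_star, mul_assoc]) η ξ

theorem inner_rightMul_right (x : M.toStarSubalgebra) (η ξ : τ.L2) :
    ⟪η, τ.rightMul x ξ⟫_ℂ = ⟪τ.rightMul (star x) η, ξ⟫_ℂ :=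
  τ.denseRange_toL2.induction_on₂ (isClosed_eq (by fun_prop) (by fun_prop)) (fun y z => by
    simp only [rightMul_toL2, inner_toL2, star_mul, star_star]
    rw [← mul_assoc, τ.map_mul_comm, mul_assoc]) η ξ

theorem toL2_mem_subL2 {P : VonNeumannAlgebra K} {x : M.toStarSubalgebra}
    (hx : (x : K →L[ℂ] K) ∈ P) : τ.toL2 x ∈ τ.subL2 P :=
  Submodule.le_topologicalClosure _ ⟨x, hx, rfl⟩

end TracialState

section TraceNormDensity

variable {K : Type*} [NormedAddCommGroup K] [InnerProductSpace ℂ K] [CompleteSpace K]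
  {M : VonNeumannAlgebra K}

/-- The elements of `M ⊆ B(K)` in the bicommutant of `S ⊆ M`, the commutants being taken in `B(K)`.
For a star-closed `S` this is the von Neumann algebra generated by `S`. -/
def bicommutant (S : Set M.toStarSubalgebra) : Set M.toStarSubalgebra :=
  {x | (x : K →L[ℂ] K) ∈ (((↑) : M.toStarSubalgebra → K →L[ℂ] K) '' S).centralizer.centralizer}

theorem star_mem_bicommutant {S : Set M.toStarSubalgebra} (hS : ∀ s ∈ S, star s ∈ S)
    {x : M.toStarSubalgebra} (hx : x ∈ bicommutant S) : star x ∈ bicommutant S := by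
  have hS' : ∀ s ∈ ((↑) : M.toStarSubalgebra → K →L[ℂ] K) '' S,
      star s ∈ ((↑) : M.toStarSubalgebra → K →L[ℂ] K) '' S := by
    rintro _ ⟨s, hs, rfl⟩
    exact ⟨star s, hS s hs, rfl⟩
  exact Set.star_mem_centralizer' (fun _ => Set.star_mem_centralizer' hS') hx

namespace TracialState

variable (τ : TracialState M)

theorem exists_norm_amplify_apply_eq :
    ∃ Ξ : lp (fun _ : ℕ => K) 2, ∀ x : M.toStarSubalgebra,
      ‖amplify ℂ K ℕ x Ξ‖ = ‖τ.toL2 x‖ := by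
  obtain ⟨ξ, h⟩ := τ.exists_hasSum_star_mul
  have hξ : Memℓp ξ 2 := memℓp_gen (by simpa using (τ.hasSum_norm_sq h 1).summable)
  refine ⟨⟨ξ, hξ⟩, fun x => (sq_eq_sq₀ (norm_nonneg _) (norm_nonneg _)).1 ?_⟩
  have hsum := lp.hasSum_norm (p := 2) (by norm_num) (amplify ℂ K ℕ x ⟨ξ, hξ⟩)
  rw [τ.norm_toL2_sq]
  refine HasSum.unique ?_ (τ.hasSum_norm_sq h x)
  simpa [amplify_apply] using hsum

theorem toL2_mem_closure_image_span {G : Submonoid M.toStarSubalgebra}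
    (hG : ∀ g ∈ G, star g ∈ G) {x : M.toStarSubalgebra} (hx : x ∈ bicommutant (G : Set _)) :
    τ.toL2 x ∈ closure (τ.toL2 '' (Submodule.span ℂ (G : Set M.toStarSubalgebra))) := by
  obtain ⟨Ξ, hΞ⟩ := τ.exists_norm_amplify_apply_eq
  let J : M.toStarSubalgebra →ₗ[ℂ] lp (fun _ : ℕ => K) 2 :=
    (ContinuousLinearMap.apply ℂ _ Ξ).toLinearMap ∘ₗ
      ((amplify ℂ K ℕ).comp M.toStarSubalgebra.subtype).toAlgHom.toLinearMap
  have hJ : ∀ x y, dist (J x) (J y) = dist (τ.toL2 x) (τ.toL2 y) := fun x y => by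
    rw [dist_eq_norm, dist_eq_norm, ← map_sub, ← map_sub]
    exact hΞ (x - y)
  have hspan : (Submodule.span ℂ (G : Set M.toStarSubalgebra)).map J =
      Submodule.span ℂ ((fun g => amplify ℂ K ℕ g Ξ) '' (G.map M.toStarSubalgebra.subtype)) := by
    rw [Submodule.map_span, Submonoid.coe_map, Set.image_image]
    rfl
  have hJx : J x ∈ closure (J '' Submodule.span ℂ (G : Set M.toStarSubalgebra)) := by
    rw [← Submodule.map_coe, hspan]
    refine amplify_apply_mem_closure_span ?_ hx Ξ
    rintro _ ⟨g, hg, rfl⟩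
    exact ⟨star g, hG g hg, rfl⟩
  simpa only [Metric.mem_closure_iff, Set.exists_mem_image, hJ] using hJx

theorem map_eq_zero_of_mem_bicommutant {F : Type*} [NormedAddCommGroup F] [NormedSpace ℂ F]
    {f : M.toStarSubalgebra →ₗ[ℂ] F} {C : ℝ} (hf : ∀ x, ‖f x‖ ≤ C * ‖τ.toL2 x‖)
    {G : Submonoid M.toStarSubalgebra} (hG : ∀ g ∈ G, star g ∈ G) (hfG : ∀ g ∈ G, f g = 0)
    {x : M.toStarSubalgebra} (hx : x ∈ bicommutant (G : Set _)) : f x = 0 := by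
  obtain ⟨s, hs, hlim⟩ := mem_closure_iff_seq_limit.1 (τ.toL2_mem_closure_image_span hG hx)
  choose y hy hys using hs
  have hfy : ∀ n, f (y n) = 0 := fun n =>
    Submodule.span_le (p := LinearMap.ker f) |>.2 hfG (hy n)
  have hbound : ∀ n, ‖f x‖ ≤ C * ‖τ.toL2 x - s n‖ := fun n => by
    simpa only [map_sub, hfy, sub_zero, hys] using hf (x - y n)
  have hzero : Tendsto (fun n => C * ‖τ.toL2 x - s n‖) atTop (𝓝 0) := by
    simpa using (hlim.const_sub (τ.toL2 x)).norm.const_mul C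
  exact norm_le_zero_iff.1 (ge_of_tendsto' hzero hbound)

end TracialState

end TraceNormDensity

section Intertwiner

variable {K L : Type*} [NormedAddCommGroup K] [InnerProductSpace ℂ K] [CompleteSpace K]
  [NormedAddCommGroup L] [InnerProductSpace ℂ L] [CompleteSpace L]
  {N : VonNeumannAlgebra K} {M : VonNeumannAlgebra L}

theorem TracialState.exists_leftMul_eq_rightMul (τ : TracialState M) {G : Type*} [Monoid G]
    (u v : G →* M.toStarSubalgebra) (hu : ∀ g, u g ∈ unitary M.toStarSubalgebra)
    (hv : ∀ g, v g ∈ unitary M.toStarSubalgebra) {c : ℝ}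
    (h : ∀ g, ‖τ.toL2 (v g) - τ.toL2 (u g)‖ ≤ c) :
    ∃ ξ ∈ Metric.closedBall (τ.toL2 1) c, ∀ g, τ.leftMul (u g) ξ = τ.rightMul (v g) ξ := by
  let : InnerProductSpace ℝ τ.L2 := InnerProductSpace.complexToReal
  let S : Set τ.L2 := Set.range fun g => τ.toL2 (star (u g) * v g)
  let T : G → τ.L2 →L[ℂ] τ.L2 := fun g => τ.leftMul (star (u g)) ∘L τ.rightMul (v g)
  have hSc : S ⊆ Metric.closedBall (τ.toL2 1) c := by
    rintro _ ⟨g, rfl⟩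
    have hsub : star (u g) * v g - 1 = star (u g) * (v g - u g) := by
      rw [mul_sub, Unitary.star_mul_self_of_mem (hu g)]
    rw [mem_closedBall_iff_norm, ← map_sub, hsub]
    refine ((τ.norm_toL2_mul_le_left _ _).trans (mul_le_of_le_one_left (norm_nonneg _)
      (norm_le_one_of_mem_unitary (Unitary.star_mem (hu g))))).trans ?_
    rw [map_sub]
    exact h g
  have hT : ∀ g, ‖T g‖ ≤ 1 := fun g =>
    (ContinuousLinearMap.opNorm_comp_le _ _).trans (mul_le_one₀
      ((τ.norm_leftMul_le _).trans (norm_le_one_of_mem_unitary (Unitary.star_mem (hu g))))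
      (norm_nonneg _) ((τ.norm_rightMul_le _).trans (norm_le_one_of_mem_unitary (hv g))))
  have hTS : ∀ g, Set.MapsTo (T g) S S := by
    rintro g _ ⟨k, rfl⟩
    refine ⟨k * g, ?_⟩
    simp [T, leftMul_toL2, rightMul_toL2, mul_assoc]
  obtain ⟨ξ, hξ, hfix⟩ := exists_mem_closedBall_fixed_of_mapsTo (Set.range_nonempty _) hSc
    (T := fun g => (T g).restrictScalars ℝ) hT hTS
  refine ⟨ξ, hξ, fun g => ?_⟩
  have hg : τ.leftMul (star (u g)) (τ.rightMul (v g) ξ) = ξ := hfix g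
  conv_lhs => rw [← hg]
  rw [← ContinuousLinearMap.comp_apply, ← leftMul_mul, Unitary.mul_star_self_of_mem (hu g),
    leftMul_one, ContinuousLinearMap.id_apply]

/-- The `*`-homomorphism `α : N → M` carries the trace of `M` to that of `N`. -/
def IsTracePreserving (σ : TracialState N) (τ : TracialState M)
    (α : N.toStarSubalgebra →⋆ₐ[ℂ] M.toStarSubalgebra) : Prop :=
  ∀ x, τ (α x) = σ x

variable {σ : TracialState N} {τ : TracialState M}
  {α β : N.toStarSubalgebra →⋆ₐ[ℂ] M.toStarSubalgebra}

theorem IsTracePreserving.norm_toL2_apply (hα : IsTracePreserving σ τ α)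
    (x : N.toStarSubalgebra) : ‖τ.toL2 (α x)‖ = ‖σ.toL2 x‖ := by
  refine (sq_eq_sq₀ (norm_nonneg _) (norm_nonneg _)).1 ?_
  rw [τ.norm_toL2_sq, σ.norm_toL2_sq, ← map_star, ← map_mul, hα]

theorem IsTracePreserving.leftMul_eq_rightMul_of_mem_bicommutant (hα : IsTracePreserving σ τ α)
    (hβ : IsTracePreserving σ τ β) {G : Submonoid N.toStarSubalgebra}
    (hG : ∀ g ∈ G, star g ∈ G) {ξ : τ.L2}
    (hξ : ∀ g ∈ G, τ.leftMul (β g) ξ = τ.rightMul (α g) ξ)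
    {x : N.toStarSubalgebra} (hx : x ∈ bicommutant (G : Set _)) :
    τ.leftMul (β x) ξ = τ.rightMul (α x) ξ := by
  refine τ.denseRange_toL2.eq_of_inner_right (𝕜 := ℂ) fun y => ?_
  let f : N.toStarSubalgebra →ₗ[ℂ] ℂ := (innerSL ℂ ξ).toLinearMap ∘ₗ τ.toL2 ∘ₗ
    (LinearMap.mulRight ℂ y ∘ₗ β.toAlgHom.toLinearMap -
      LinearMap.mulLeft ℂ y ∘ₗ α.toAlgHom.toLinearMap)
  have hf_apply : ∀ z, f z = ⟪ξ, τ.toL2 (β z * y)⟫_ℂ - ⟪ξ, τ.toL2 (y * α z)⟫_ℂ := fun z => by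
    rw [← inner_sub_right, ← map_sub]; rfl
  have hf_star : ∀ z, f (star z) = 0 ↔
      ⟪τ.toL2 y, τ.leftMul (β z) ξ⟫_ℂ = ⟪τ.toL2 y, τ.rightMul (α z) ξ⟫_ℂ := fun z => by
    rw [hf_apply, sub_eq_zero, τ.inner_leftMul_right, τ.inner_rightMul_right, τ.leftMul_toL2,
      τ.rightMul_toL2, map_star, map_star, ← inner_conj_symm, ← inner_conj_symm ξ,
      (starRingEnd ℂ).injective.eq_iff]
  have hf_bound : ∀ z, ‖f z‖ ≤ ‖ξ‖ * (‖y‖ + ‖y‖) * ‖σ.toL2 z‖ := fun z => by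
    rw [hf_apply, ← inner_sub_right, mul_assoc, add_mul]
    refine (norm_inner_le_norm _ _).trans (mul_le_mul_of_nonneg_left ?_ (norm_nonneg ξ))
    refine (norm_sub_le _ _).trans (add_le_add ?_ ?_)
    · exact (τ.norm_toL2_mul_le_right _ _).trans_eq (by rw [hβ.norm_toL2_apply])
    · exact (τ.norm_toL2_mul_le_left _ _).trans_eq (by rw [hα.norm_toL2_apply])
  have hfG : ∀ g ∈ G, f g = 0 := fun g hg => by
    rw [← star_star g, hf_star, hξ _ (hG g hg)]
  exact (hf_star x).1
    (σ.map_eq_zero_of_mem_bicommutant hf_bound hG hfG (star_mem_bicommutant hG hx))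

theorem IsTracePreserving.norm_toL2_sub_le_of_mem_bicommutant (hα : IsTracePreserving σ τ α)
    (hβ : IsTracePreserving σ τ β) {G : Submonoid N.toStarSubalgebra}
    (hG : ∀ g ∈ G, star g ∈ G) (hGu : G ≤ unitary N.toStarSubalgebra) {c : ℝ}
    (hc : ∀ g ∈ G, ‖τ.toL2 (α g) - τ.toL2 (β g)‖ ≤ c)
    {x : N.toStarSubalgebra} (hx : x ∈ bicommutant (G : Set _)) (hx1 : ‖x‖ ≤ 1) :
    ‖τ.toL2 (α x) - τ.toL2 (β x)‖ ≤ 2 * c := by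
  obtain ⟨ξ, hξ, hfix⟩ := τ.exists_leftMul_eq_rightMul
    ((β : N.toStarSubalgebra →* M.toStarSubalgebra).comp G.subtype)
    ((α : N.toStarSubalgebra →* M.toStarSubalgebra).comp G.subtype)
    (fun g => Unitary.map_mem β (hGu g.2)) (fun g => Unitary.map_mem α (hGu g.2))
    (fun g => hc g g.2)
  have hxξ : τ.leftMul (β x) ξ = τ.rightMul (α x) ξ :=
    hα.leftMul_eq_rightMul_of_mem_bicommutant hβ hG (fun g hg => hfix ⟨g, hg⟩) hx
  rw [mem_closedBall_iff_norm] at hξ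
  have hsub : τ.toL2 (α x) - τ.toL2 (β x) =
      τ.leftMul (β x) (ξ - τ.toL2 1) - τ.rightMul (α x) (ξ - τ.toL2 1) := by
    rw [map_sub, map_sub, hxξ, τ.leftMul_toL2, τ.rightMul_toL2, mul_one, one_mul]
    abel
  rw [hsub, two_mul]
  refine (norm_sub_le _ _).trans (add_le_add ?_ ?_)
  · exact ((τ.leftMul _).le_of_opNorm_le ((τ.norm_leftMul_le _).trans
      ((norm_starAlgHom_apply_le β x).trans hx1)) _).trans (by rwa [one_mul])
  · exact ((τ.rightMul _).le_of_opNorm_le ((τ.norm_rightMul_le _).trans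
      ((norm_starAlgHom_apply_le α x).trans hx1)) _).trans (by rwa [one_mul])

end Intertwiner

section Dilation

variable {K : Type*} [NormedAddCommGroup K] [InnerProductSpace ℂ K] [CompleteSpace K]
  {M N : VonNeumannAlgebra K}

theorem coe_incl_mem (hNM : N ≤ M) (x : N.toStarSubalgebra) :
    (VonNeumannAlgebra.incl hNM x : K →L[ℂ] K) ∈ N :=
  x.2

theorem incl_injective (hNM : N ≤ M) : Function.Injective (VonNeumannAlgebra.incl hNM) :=
  StarSubalgebra.inclusion_injective (S₁ := N.toStarSubalgebra) hNM

namespace TracialState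

/-- The restriction of a faithful normal tracial state to a von Neumann subalgebra. -/
noncomputable def restrict (hNM : N ≤ M) (τ : TracialState M) : TracialState N where
  toLinearMap := τ.toLinearMap ∘ₗ (VonNeumannAlgebra.incl hNM).toAlgHom.toLinearMap
  map_one := τ.map_one
  map_mul_comm x y := τ.map_mul_comm (VonNeumannAlgebra.incl hNM x) (VonNeumannAlgebra.incl hNM y)
  faithful x hx := incl_injective hNM <|
    (τ.faithful (VonNeumannAlgebra.incl hNM x) hx).trans (map_zero _).symm
  normal := τ.normal.imp fun _ h => ⟨h.1, fun x => h.2 (VonNeumannAlgebra.incl hNM x)⟩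

theorem isTracePreserving_incl (hNM : N ≤ M) (τ : TracialState M) :
    IsTracePreserving (τ.restrict hNM) τ (VonNeumannAlgebra.incl hNM) := fun _ => rfl

theorem inner_toL2_incl (hNM : N ≤ M) (τ : TracialState M) (x y : N.toStarSubalgebra) :
    ⟪τ.toL2 (VonNeumannAlgebra.incl hNM x), τ.toL2 (VonNeumannAlgebra.incl hNM y)⟫_ℂ =
      τ.restrict hNM (star x * y) :=
  τ.inner_toL2 _ _

/-- A linear map on `N` that is symmetric for the form `(x, y) ↦ σ(x y)`. -/
def IsSymmetric (σ : TracialState N) (φ : N.toStarSubalgebra →ₗ[ℂ] N.toStarSubalgebra) : Prop :=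
  ∀ x y, σ (φ x * y) = σ (x * φ y)

theorem IsSymmetric.comp_self {σ : TracialState N}
    {φ : N.toStarSubalgebra →ₗ[ℂ] N.toStarSubalgebra} (hφ : σ.IsSymmetric φ) :
    σ.IsSymmetric (φ ∘ₗ φ) := fun x y =>
  (hφ (φ x) y).trans (hφ x (φ y))

end TracialState

/-- The `*`-homomorphism `α : N → M` dilates the linear map `φ` on `N`: `E_N ∘ α = φ`. -/
def Dilates (hNM : N ≤ M) (τ : TracialState M)
    (α : N.toStarSubalgebra →⋆ₐ[ℂ] M.toStarSubalgebra)
    (φ : N.toStarSubalgebra →ₗ[ℂ] N.toStarSubalgebra) : Prop :=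
  ∀ x, τ.condExp N (α x) = τ.toL2 (VonNeumannAlgebra.incl hNM (φ x))

namespace Dilates

variable {hNM : N ≤ M} {τ : TracialState M}
  {α β : N.toStarSubalgebra →⋆ₐ[ℂ] M.toStarSubalgebra}
  {φ : N.toStarSubalgebra →ₗ[ℂ] N.toStarSubalgebra}

theorem toL2_sub_mem_orthogonal (hα : Dilates hNM τ α φ) (x : N.toStarSubalgebra) :
    τ.toL2 (α x - VonNeumannAlgebra.incl hNM (φ x)) ∈ (τ.subL2 N)ᗮ := by
  rw [map_sub, ← hα x]
  exact Submodule.sub_starProjection_mem_orthogonal _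

theorem inner_toL2_apply (hα : Dilates hNM τ α φ) (x y : N.toStarSubalgebra) :
    ⟪τ.toL2 (VonNeumannAlgebra.incl hNM y), τ.toL2 (α x)⟫_ℂ =
      τ.restrict hNM (star y * φ x) := by
  rw [← τ.inner_toL2_incl, ← sub_eq_zero, ← inner_sub_right, ← map_sub]
  exact (Submodule.mem_orthogonal _ _).1 (hα.toL2_sub_mem_orthogonal x) _
    (τ.toL2_mem_subL2 (coe_incl_mem hNM y))

theorem map_one (hα : Dilates hNM τ α φ) : φ 1 = 1 := by
  refine incl_injective hNM (τ.toL2_injective ?_)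
  rw [← hα 1, _root_.map_one, _root_.map_one]
  exact Submodule.starProjection_eq_self_iff.2 (τ.toL2_mem_subL2 (one_mem N))

theorem isTracePreserving (hα : Dilates hNM τ α φ)
    (hφ : (τ.restrict hNM).IsSymmetric φ) :
    IsTracePreserving (τ.restrict hNM) τ α := fun x =>
  calc τ (α x) = τ.restrict hNM (φ x * 1) := by
        simpa [τ.inner_toL2] using hα.inner_toL2_apply x 1
    _ = τ.restrict hNM x := by rw [hφ, hα.map_one, mul_one]

theorem inner_toL2_apply_of_comp_self (hα : Dilates hNM τ α φ) (hβ : Dilates hNM τ β (φ ∘ₗ φ))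
    (hφ : (τ.restrict hNM).IsSymmetric φ) (x : N.toStarSubalgebra) :
    ⟪τ.toL2 (VonNeumannAlgebra.incl hNM x), τ.toL2 (β x)⟫_ℂ =
      ⟪τ.toL2 (VonNeumannAlgebra.incl hNM (φ x)),
        τ.toL2 (VonNeumannAlgebra.incl hNM (φ x))⟫_ℂ := by
  have h_star : τ.restrict hNM (φ (star x) * φ x) =
      τ (star (α x) * VonNeumannAlgebra.incl hNM (φ x)) := by
    have h := hα.inner_toL2_apply (star x) (star (φ x))
    rw [star_star, (τ.restrict hNM).map_mul_comm] at h
    rw [← h, τ.inner_toL2, map_star, map_star, star_star, τ.map_mul_comm]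
  calc ⟪τ.toL2 (VonNeumannAlgebra.incl hNM x), τ.toL2 (β x)⟫_ℂ
      = τ.restrict hNM (star x * φ (φ x)) := hβ.inner_toL2_apply x x
    _ = ⟪τ.toL2 (α x), τ.toL2 (VonNeumannAlgebra.incl hNM (φ x))⟫_ℂ := by
        rw [← hφ, h_star, τ.inner_toL2]
    _ = _ := by rw [← inner_conj_symm, hα.inner_toL2_apply, ← τ.inner_toL2_incl, inner_conj_symm]

/-- Popa's transversality, which for a symmetric dilation is an identity. -/
theorem norm_toL2_sub_sq (hα : Dilates hNM τ α φ) (hβ : Dilates hNM τ β (φ ∘ₗ φ))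
    (hφ : (τ.restrict hNM).IsSymmetric φ) (x : N.toStarSubalgebra) :
    ‖τ.toL2 (β x) - τ.toL2 (VonNeumannAlgebra.incl hNM x)‖ ^ 2 =
      2 * ‖τ.toL2 (α x - VonNeumannAlgebra.incl hNM (φ x))‖ ^ 2 := by
  have hα_sq : ‖τ.toL2 (α x - VonNeumannAlgebra.incl hNM (φ x))‖ ^ 2 =
      ‖(τ.restrict hNM).toL2 x‖ ^ 2 - ‖τ.toL2 (VonNeumannAlgebra.incl hNM (φ x))‖ ^ 2 := by
    rw [map_sub, norm_sub_rev, norm_sub_sq (𝕜 := ℂ), hα.inner_toL2_apply,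
      ← τ.inner_toL2_incl, inner_self_eq_norm_sq, (hα.isTracePreserving hφ).norm_toL2_apply]
    ring
  rw [hα_sq, norm_sub_rev, norm_sub_sq (𝕜 := ℂ), hα.inner_toL2_apply_of_comp_self hβ hφ,
    inner_self_eq_norm_sq, (hβ.isTracePreserving hφ.comp_self).norm_toL2_apply,
    (τ.isTracePreserving_incl hNM).norm_toL2_apply]
  ring

end Dilates

end Dilation

section Normalizer

variable {K : Type*} [NormedAddCommGroup K] [InnerProductSpace ℂ K] [CompleteSpace K]
  {N A : VonNeumannAlgebra K}

theorem star_mem_normalizerSet {u : K →L[ℂ] K} (hu : u ∈ normalizerSet N A) :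
    star u ∈ normalizerSet N A := by
  have hcancel : ∀ a, star u * (u * a * star u) * star (star u) = a := fun a => by
    rw [star_star, mul_assoc, mul_assoc (u * a), Unitary.star_mul_self_of_mem hu.2.1, mul_one,
      ← mul_assoc, Unitary.star_mul_self_of_mem hu.2.1, one_mul]
  refine ⟨star_mem hu.1, Unitary.star_mem hu.2.1, ?_⟩
  conv_lhs => rw [← hu.2.2, Set.image_image]
  simp only [hcancel, Set.image_id']

/-- `𝒩_N(A)` as a submonoid of `N`, rather than as a set of operators. -/
def normalizer (N A : VonNeumannAlgebra K) : Submonoid N.toStarSubalgebra where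
  carrier := {u | (u : K →L[ℂ] K) ∈ normalizerSet N A}
  one_mem' := ⟨one_mem N, one_mem _, by simp⟩
  mul_mem' {u v} hu hv := by
    refine ⟨(u * v).2, mul_mem hu.2.1 hv.2.1, ?_⟩
    conv_rhs => rw [← hu.2.2, ← hv.2.2, Set.image_image]
    simp [mul_assoc]

theorem normalizer_le_unitary : normalizer N A ≤ unitary N.toStarSubalgebra := fun _ hu =>
  ⟨Subtype.ext hu.2.1.1, Subtype.ext hu.2.1.2⟩

theorem conj_mem_of_mem_normalizer {w a : N.toStarSubalgebra} (hw : w ∈ normalizer N A)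
    (ha : (a : K →L[ℂ] K) ∈ A) : ((w * a * star w : N.toStarSubalgebra) : K →L[ℂ] K) ∈ A :=
  (Set.ext_iff.1 hw.2.2 _).1 ⟨a, ha, rfl⟩

theorem mem_bicommutant_normalizer {x : N.toStarSubalgebra} :
    x ∈ bicommutant (normalizer N A : Set N.toStarSubalgebra) ↔
      (x : K →L[ℂ] K) ∈ (normalizerSet N A).centralizer.centralizer := by
  have himage : ((↑) : N.toStarSubalgebra → K →L[ℂ] K) '' normalizer N A = normalizerSet N A :=
    Set.ext fun u => ⟨by rintro ⟨u, hu, rfl⟩; exact hu, fun hu => ⟨⟨u, hu.1⟩, hu, rfl⟩⟩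
  rw [← himage]
  rfl

end Normalizer

section Mixing

theorem norm_le_of_tendsto_inner_zero {𝕜 E ι : Type*} [RCLike 𝕜] [NormedAddCommGroup E]
    [InnerProductSpace 𝕜 E] {l : Filter ι} [l.NeBot] {ξ : E} {ζ : ι → E} {c : ℝ}
    (hc : ∀ i, ‖ξ - ζ i‖ ≤ c) (hζ : Tendsto (fun i => inner 𝕜 ξ (ζ i)) l (𝓝 0)) : ‖ξ‖ ≤ c := by
  have hbound : ∀ i, ‖inner 𝕜 ξ ξ - inner 𝕜 ξ (ζ i)‖ ≤ ‖ξ‖ * c := fun i => by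
    rw [← inner_sub_right]
    exact (norm_inner_le_norm _ _).trans (mul_le_mul_of_nonneg_left (hc i) (norm_nonneg ξ))
  have hlim : Tendsto (fun i => ‖inner 𝕜 ξ ξ - inner 𝕜 ξ (ζ i)‖) l (𝓝 (‖ξ‖ * ‖ξ‖)) := by
    simpa [sq] using (hζ.const_sub (inner 𝕜 ξ ξ)).norm
  have hmul : ‖ξ‖ * ‖ξ‖ ≤ ‖ξ‖ * c := le_of_tendsto' hlim hbound
  obtain ⟨i⟩ := l.nonempty_of_neBot
  rcases (norm_nonneg ξ).eq_or_lt with hξ | hξ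
  · exact hξ.symm.trans_le ((norm_nonneg _).trans (hc i))
  · exact le_of_mul_le_mul_left hmul hξ

theorem norm_le_norm_add_of_inner_eq_zero {𝕜 E : Type*} [RCLike 𝕜] [NormedAddCommGroup E]
    [InnerProductSpace 𝕜 E] {a b : E} (h : inner 𝕜 a b = 0) : ‖b‖ ≤ ‖a + b‖ := by
  refine le_of_sq_le_sq ?_ (norm_nonneg _)
  rw [norm_add_sq (𝕜 := 𝕜), h]
  simp

namespace TracialState

variable {K : Type*} [NormedAddCommGroup K] [InnerProductSpace ℂ K] [CompleteSpace K]
  {M N A B : VonNeumannAlgebra K} (τ : TracialState M)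

/-- The sequence `x` in `M` vanishes relative to `B` inside `N`: `‖E_B(y xₖ z)‖₂ → 0` for all
`y, z ∈ N`. -/
def VanishesRelative (B N : VonNeumannAlgebra K) (x : ℕ → M.toStarSubalgebra) : Prop :=
  ∀ y z : M.toStarSubalgebra, (y : K →L[ℂ] K) ∈ N → (z : K →L[ℂ] K) ∈ N →
    Tendsto (fun k => ‖τ.condExp B (y * x k * z)‖) atTop (𝓝 0)

variable {τ}

theorem VanishesRelative.mul_mul {x : ℕ → M.toStarSubalgebra} (hx : τ.VanishesRelative B N x)
    {a b : M.toStarSubalgebra} (ha : (a : K →L[ℂ] K) ∈ N) (hb : (b : K →L[ℂ] K) ∈ N) :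
    τ.VanishesRelative B N fun k => a * x k * b := fun y z hy hz => by
  simpa only [mul_assoc] using hx (y * a) (b * z) (mul_mem hy ha) (mul_mem hb hz)

theorem exists_unitary_vanishesRelative (hNM : N ≤ M) (hAN : A ≤ N)
    (hAB : ¬ τ.EmbedsInside A B N) :
    ∃ v : ℕ → N.toStarSubalgebra, (∀ k, (v k : K →L[ℂ] K) ∈ A) ∧
      (∀ k, v k ∈ unitary N.toStarSubalgebra) ∧
      τ.VanishesRelative B N fun k => VonNeumannAlgebra.incl hNM (v k) := by
  obtain ⟨u, hu, hlim⟩ := not_not.1 hAB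
  refine ⟨fun k => ⟨u k, hAN (hu k).1⟩, fun k => (hu k).1, fun k => ?_, fun y z hy hz => ?_⟩
  · exact ⟨incl_injective hNM (hu k).2.1, incl_injective hNM (hu k).2.2⟩
  · have h := hlim (star y) z (star_mem hy) hz
    rwa [star_star] at h

variable (τ)

theorem leftMul_mem_orthogonal_subL2 {y : M.toStarSubalgebra} (hy : (y : K →L[ℂ] K) ∈ N)
    {ξ : τ.L2} (hξ : ξ ∈ (τ.subL2 N)ᗮ) : τ.leftMul y ξ ∈ (τ.subL2 N)ᗮ := by
  refine (Submodule.mem_orthogonal _ _).2 fun η hη => ?_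
  rw [inner_leftMul_right]
  refine (Submodule.mem_orthogonal _ _).1 hξ _
    (map_mem_closure (τ.leftMul (star y)).continuous hη ?_)
  rintro _ ⟨x, hx, rfl⟩
  exact ⟨star y * x, N.mul_mem' (star_mem hy) hx, (τ.leftMul_toL2 _ _).symm⟩

theorem rightMul_mem_orthogonal_subL2 {y : M.toStarSubalgebra} (hy : (y : K →L[ℂ] K) ∈ N)
    {ξ : τ.L2} (hξ : ξ ∈ (τ.subL2 N)ᗮ) : τ.rightMul y ξ ∈ (τ.subL2 N)ᗮ := by
  refine (Submodule.mem_orthogonal _ _).2 fun η hη => ?_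
  rw [inner_rightMul_right]
  refine (Submodule.mem_orthogonal _ _).1 hξ _
    (map_mem_closure (τ.rightMul (star y)).continuous hη ?_)
  rintro _ ⟨x, hx, rfl⟩
  exact ⟨x * star y, N.mul_mem' hx (star_mem hy), (τ.rightMul_toL2 _ _).symm⟩

theorem norm_sub_leftMul_rightMul_star_le {v : M.toStarSubalgebra}
    (hv : v ∈ unitary M.toStarSubalgebra) (a : M.toStarSubalgebra) (ξ : τ.L2) :
    ‖ξ - τ.leftMul a (τ.rightMul (star v) ξ)‖ ≤ ‖τ.rightMul v ξ - τ.leftMul a ξ‖ := by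
  have hfactor : ξ - τ.leftMul a (τ.rightMul (star v) ξ) =
      τ.rightMul (star v) (τ.rightMul v ξ - τ.leftMul a ξ) := by
    simp only [map_sub, ← ContinuousLinearMap.comp_apply, leftMul_comp_rightMul, ← rightMul_mul,
      Unitary.mul_star_self_of_mem hv, rightMul_one, ContinuousLinearMap.id_apply]
  rw [hfactor]
  exact ((τ.rightMul _).le_of_opNorm_le ((τ.norm_rightMul_le _).trans
    (norm_le_one_of_mem_unitary (Unitary.star_mem hv))) _).trans_eq (one_mul _)

theorem norm_toL2_mul_sub_mul_le {p q r : M.toStarSubalgebra} (h : p * r = r * q)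
    (p' q' : M.toStarSubalgebra) :
    ‖τ.toL2 (r * q' - p' * r)‖ ≤ ‖r‖ * (‖τ.toL2 p - τ.toL2 p'‖ + ‖τ.toL2 q - τ.toL2 q'‖) := by
  have hsplit : r * q' - p' * r = (p - p') * r - r * (q - q') := by
    rw [sub_mul, mul_sub, h]
    abel
  rw [hsplit, map_sub τ.toL2 (_ * _), mul_add, ← map_sub τ.toL2 p, ← map_sub τ.toL2 q]
  exact (norm_sub_le _ _).trans
    (add_le_add (τ.norm_toL2_mul_le_right _ _) (τ.norm_toL2_mul_le_left _ _))

end TracialState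

variable {K : Type*} [NormedAddCommGroup K] [InnerProductSpace ℂ K] [CompleteSpace K]
  {M N A B : VonNeumannAlgebra K} {hNM : N ≤ M} {τ : TracialState M} {H : Submodule ℂ τ.L2}
  {α β : N.toStarSubalgebra →⋆ₐ[ℂ] M.toStarSubalgebra}
  {φ : N.toStarSubalgebra →ₗ[ℂ] N.toStarSubalgebra} {ε : ℝ}

theorem Dilates.norm_rightMul_sub_leftMul_le (hα : Dilates hNM τ α φ)
    (w a v : N.toStarSubalgebra) :
    ‖τ.rightMul (VonNeumannAlgebra.incl hNM v)
          (τ.toL2 (α w - VonNeumannAlgebra.incl hNM (φ w))) -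
        τ.leftMul (VonNeumannAlgebra.incl hNM a)
          (τ.toL2 (α w - VonNeumannAlgebra.incl hNM (φ w)))‖ ≤
      ‖τ.toL2 (α w * VonNeumannAlgebra.incl hNM v - VonNeumannAlgebra.incl hNM a * α w)‖ := by
  let δ := τ.toL2 (α w - VonNeumannAlgebra.incl hNM (φ w))
  let η := τ.toL2 (VonNeumannAlgebra.incl hNM (φ w * v - a * φ w))
  have hδ : δ ∈ (τ.subL2 N)ᗮ := hα.toL2_sub_mem_orthogonal w
  have hsplit : τ.toL2 (α w * VonNeumannAlgebra.incl hNM v - VonNeumannAlgebra.incl hNM a * α w) =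
      η + (τ.rightMul (VonNeumannAlgebra.incl hNM v) δ -
        τ.leftMul (VonNeumannAlgebra.incl hNM a) δ) := by
    simp only [η, δ, τ.rightMul_toL2, τ.leftMul_toL2, ← map_sub, ← map_add]
    congr 1
    simp only [map_sub, map_mul]
    noncomm_ring
  rw [hsplit]
  refine norm_le_norm_add_of_inner_eq_zero (𝕜 := ℂ)
    ((Submodule.mem_orthogonal _ _).1 (sub_mem ?_ ?_) η (τ.toL2_mem_subL2 (coe_incl_mem hNM _)))
  · exact τ.rightMul_mem_orthogonal_subL2 (coe_incl_mem hNM v) hδ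
  · exact τ.leftMul_mem_orthogonal_subL2 (coe_incl_mem hNM a) hδ

theorem Dilates.norm_toL2_sub_le_of_mem_normalizer (hα : Dilates hNM τ α φ) (hAN : A ≤ N)
    (hcomp : τ.IsCompactRelative A B N H) (hAB : ¬ τ.EmbedsInside A B N)
    (hε : ∀ x : N.toStarSubalgebra, (x : K →L[ℂ] K) ∈ A → ‖x‖ ≤ 1 →
      ‖τ.toL2 (α x) - τ.toL2 (VonNeumannAlgebra.incl hNM x)‖ ≤ ε)
    {w : N.toStarSubalgebra} (hw : w ∈ normalizer N A)
    (hH : τ.toL2 (α w - VonNeumannAlgebra.incl hNM (φ w)) ∈ H) :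
    ‖τ.toL2 (α w - VonNeumannAlgebra.incl hNM (φ w))‖ ≤ 2 * ε := by
  let i := VonNeumannAlgebra.incl hNM
  let δ := τ.toL2 (α w - i (φ w))
  have hwu : w ∈ unitary N.toStarSubalgebra := normalizer_le_unitary hw
  obtain ⟨v, hvA, hvu, hv⟩ := τ.exists_unitary_vanishesRelative hNM hAN hAB
  let a : ℕ → N.toStarSubalgebra := fun k => w * v k * star w
  have hau : ∀ k, a k ∈ unitary N.toStarSubalgebra := fun k =>
    mul_mem (mul_mem hwu (hvu k)) (Unitary.star_mem hwu)
  have haA : ∀ k, (a k : K →L[ℂ] K) ∈ A := fun k => conj_mem_of_mem_normalizer hw (hvA k)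
  have ha : τ.VanishesRelative B N fun k => i (a k) := by
    simpa only [i, a, map_mul] using hv.mul_mul w.2 (star w).2
  have hmixing : Tendsto
      (fun k => ⟪δ, τ.leftMul (i (a k)) (τ.rightMul (star (i (v k))) δ)⟫_ℂ) atTop (𝓝 0) :=
    hcomp _ (fun k => ⟨haA k, norm_le_one_of_mem_unitary (Unitary.map_mem i (hau k))⟩) ha _
      (fun k => ⟨star_mem (hvA k),
        norm_le_one_of_mem_unitary (Unitary.star_mem (Unitary.map_mem i (hvu k)))⟩) δ hH
  have hintertwine : ∀ k, α (a k) * α w = α w * α (v k) := fun k => by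
    rw [← map_mul, ← map_mul, mul_assoc, Unitary.star_mul_self_of_mem hwu, mul_one]
  refine norm_le_of_tendsto_inner_zero (fun k => ?_) hmixing
  calc ‖δ - τ.leftMul (i (a k)) (τ.rightMul (star (i (v k))) δ)‖
      ≤ ‖τ.rightMul (i (v k)) δ - τ.leftMul (i (a k)) δ‖ :=
        τ.norm_sub_leftMul_rightMul_star_le (Unitary.map_mem i (hvu k)) _ _
    _ ≤ ‖τ.toL2 (α w * i (v k) - i (a k) * α w)‖ := hα.norm_rightMul_sub_leftMul_le w _ _
    _ ≤ ‖α w‖ * (‖τ.toL2 (α (a k)) - τ.toL2 (i (a k))‖ +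
          ‖τ.toL2 (α (v k)) - τ.toL2 (i (v k))‖) :=
        τ.norm_toL2_mul_sub_mul_le (hintertwine k) _ _
    _ ≤ 1 * (ε + ε) := by
      gcongr
      · exact norm_le_one_of_mem_unitary (Unitary.map_mem α hwu)
      · exact hε _ (haA k) (norm_le_one_of_mem_unitary (hau k))
      · exact hε _ (hvA k) (norm_le_one_of_mem_unitary (hvu k))
    _ = 2 * ε := by ring

theorem Dilates.norm_toL2_sub_le_of_mem_bicommutant_normalizer (hα : Dilates hNM τ α φ)
    (hβ : Dilates hNM τ β (φ ∘ₗ φ)) (hφ : (τ.restrict hNM).IsSymmetric φ) (hAN : A ≤ N)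
    (hcomp : τ.IsCompactRelative A B N H) (hAB : ¬ τ.EmbedsInside A B N)
    (hH : ∀ x, τ.toL2 (α x - VonNeumannAlgebra.incl hNM (φ x)) ∈ H)
    (hε : ∀ x : N.toStarSubalgebra, (x : K →L[ℂ] K) ∈ A → ‖x‖ ≤ 1 →
      ‖τ.toL2 (α x) - τ.toL2 (VonNeumannAlgebra.incl hNM x)‖ ≤ ε)
    {x : N.toStarSubalgebra} (hx : x ∈ bicommutant (normalizer N A : Set N.toStarSubalgebra))
    (hx1 : ‖x‖ ≤ 1) :
    ‖τ.toL2 (β x) - τ.toL2 (VonNeumannAlgebra.incl hNM x)‖ ≤ 6 * ε := by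
  have hε0 : 0 ≤ ε := (norm_nonneg _).trans (hε 0 (zero_mem A) (by simp))
  have hnormalizer : ∀ w ∈ normalizer N A,
      ‖τ.toL2 (β w) - τ.toL2 (VonNeumannAlgebra.incl hNM w)‖ ≤ 3 * ε := fun w hw => by
    have hw2 := hα.norm_toL2_sub_le_of_mem_normalizer hAN hcomp hAB hε hw (hH w)
    refine le_of_sq_le_sq ?_ (by positivity)
    calc ‖τ.toL2 (β w) - τ.toL2 (VonNeumannAlgebra.incl hNM w)‖ ^ 2
        = 2 * ‖τ.toL2 (α w - VonNeumannAlgebra.incl hNM (φ w))‖ ^ 2 :=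
          hα.norm_toL2_sub_sq hβ hφ w
      _ ≤ 2 * (2 * ε) ^ 2 := by gcongr
      _ ≤ (3 * ε) ^ 2 := by nlinarith
  calc _ ≤ 2 * (3 * ε) := (hβ.isTracePreserving hφ.comp_self).norm_toL2_sub_le_of_mem_bicommutant
        (τ.isTracePreserving_incl hNM) (fun _ => star_mem_normalizerSet) normalizer_le_unitary
        hnormalizer hx hx1
    _ = 6 * ε := by ring

end Mixing

theorem theorem5p3_general {K : Type*} [NormedAddCommGroup K] [InnerProductSpace ℂ K]
    [CompleteSpace K] {M N A B : VonNeumannAlgebra K} {hNM : N ≤ M} (hAN : A ≤ N)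
    {τ : TracialState M} {H : Submodule ℂ τ.L2} (hcomp : τ.IsCompactRelative A B N H)
    (hAB : ¬ τ.EmbedsInside A B N) {ι : Type*} {l : Filter ι}
    {φ : ι → N.toStarSubalgebra →ₗ[ℂ] N.toStarSubalgebra}
    {α β : ι → N.toStarSubalgebra →⋆ₐ[ℂ] M.toStarSubalgebra}
    (hφ : ∀ i, (τ.restrict hNM).IsSymmetric (φ i)) (hα : ∀ i, Dilates hNM τ (α i) (φ i))
    (hβ : ∀ i, Dilates hNM τ (β i) (φ i ∘ₗ φ i))
    (hrange : ∀ i x, τ.toL2 (α i x - VonNeumannAlgebra.incl hNM (φ i x)) ∈ H)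
    (hA : TendstoUniformlyOn (fun i x => τ.toL2 (α i x))
      (fun x => τ.toL2 (VonNeumannAlgebra.incl hNM x)) l
      {x : N.toStarSubalgebra | (x : K →L[ℂ] K) ∈ A ∧ ‖x‖ ≤ 1}) :
    TendstoUniformlyOn (fun i x => τ.toL2 (β i x))
      (fun x => τ.toL2 (VonNeumannAlgebra.incl hNM x)) l
      {x : N.toStarSubalgebra |
        (x : K →L[ℂ] K) ∈ (normalizerSet N A).centralizer.centralizer ∧ ‖x‖ ≤ 1} := by
  simp only [Metric.tendstoUniformlyOn_iff, dist_comm, dist_eq_norm] at hA ⊢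
  intro ε hε
  filter_upwards [hA (ε / 7) (by positivity)] with i hi x hx
  calc _ ≤ 6 * (ε / 7) := (hα i).norm_toL2_sub_le_of_mem_bicommutant_normalizer (hβ i) (hφ i)
        hAN hcomp hAB (hrange i) (fun y hyA hy1 => (hi y ⟨hyA, hy1⟩).le)
        (mem_bicommutant_normalizer.2 hx.1) hx.2
    _ < ε := by linarith

theorem tendsto_half_nhdsGT_zero :
    Tendsto (fun t : ℝ≥0 => t / 2) (𝓝[>] 0) (𝓝[>] 0) := by
  refine tendsto_nhdsWithin_iff.2 ⟨?_, ?_⟩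
  · have h : Tendsto (fun t : ℝ≥0 => t / 2) (𝓝 0) (𝓝 (0 / 2)) :=
      Continuous.tendsto (by fun_prop) 0
    rw [zero_div] at h
    exact h.mono_left nhdsWithin_le_nhds
  · filter_upwards [self_mem_nhdsWithin] with t ht using half_pos (Set.mem_Ioi.1 ht)

theorem theorem5p3 {K : Type*} [NormedAddCommGroup K] [InnerProductSpace ℂ K] [CompleteSpace K]
    (M N A B : VonNeumannAlgebra K) (hNM : N ≤ M) (hAN : A ≤ N) (hBN : B ≤ N)
    (τ : TracialState M)
    (H : Submodule ℂ τ.L2) (hH : τ.IsHilbertBimodule N H) (hHN : H ≤ (τ.subL2 N)ᗮ)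
    (hcomp : τ.IsCompactRelative A B N H)
    (φ : ℝ≥0 → N.toStarSubalgebra →ₗ[ℂ] N.toStarSubalgebra)
    (hφ : IsSymmetricSemigroup hNM τ φ)
    (α : ℝ≥0 → N.toStarSubalgebra →⋆ₐ[ℂ] M.toStarSubalgebra)
    (hα : IsDilation hNM τ α φ)
    (hrange : ∀ t x, τ.toL2 (α t x - VonNeumannAlgebra.incl hNM (φ t x)) ∈ H)
    (hAB : ¬ τ.EmbedsInside A B N)
    (hA : ConvergesUniformlyOnBall hNM τ α A) :
    ConvergesUniformlyOnBall hNM τ α (normalizerSet N A).centralizer.centralizer :=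
  have hβ (t : ℝ≥0) : Dilates hNM τ (α t) (φ (t / 2) ∘ₗ φ (t / 2)) := by
    rw [← hφ.add, add_halves]
    exact hα t
  theorem5p3_general hAN hcomp hAB (fun t => hφ.symm (t / 2)) (fun t => hα (t / 2)) hβ
    (fun t => hrange (t / 2)) fun u hu => tendsto_half_nhdsGT_zero.eventually (hA u hu)
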